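/- Let $n\ge 1$ and $\sigma>0$ be given. For a random vector $\mathbf V$ in $\mathbb R^n$ write $\vec{\mathbf V}$ for $\mathbf V$ with its entries rearranged in ascending order, $\mathrm{mmse}(\mathbf V|\mathbf U)=\mathbb E\big[\|\mathbf V-\mathbb E[\mathbf V|\mathbf U]\|^2\big]$, $\mathsf{Var}(\mathbf V)=\mathbb E\big[\|\mathbf V-\mathbb E[\mathbf V]\|^2\big]$, and $h(\mathbf V)=-\int f_{\mathbf V}\log f_{\mathbf V}$ for the differential entropy of a vector with Lebesgue density $f_{\mathbf V}$. Let $\mathbf X\sim\mathcal N(\mathbf 0_n,\mathbf I_n)$ and let $\mathbf Y=\mathbf Y_\sigma$ satisfy $\mathbf Y\,|\,\mathbf X=\mathbf x\sim\mathcal N(\mathbf x,\sigma^2\mathbf I_n)$. Then $$\mathrm{mmse}(\vec{\mathbf X}|\vec{\mathbf Y})\ \ge\ \frac{1}{(n!)^{2/n}}\,\mathrm{mmse}(\mathbf X|\mathbf Y),\qquad \mathrm{mmse}(\mathbf X|\mathbf Y)=n\,\frac{\sigma^2}{1+\sigma^2}.$$ As $\sigma\to\infty$ the left side of this inequality tends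 to $\mathsf{Var}(\vec{\mathbf X})$ and the right side to $n/(n!)^{2/n}$. The vector $\vec{\mathbf X}$ has a Lebesgue density $f$ with $f\log f$ integrable, and $$\mathsf{Var}(\vec{\mathbf X})\ \ge\ \frac{n}{2\pi \mathrm e}\,\mathrm e^{\frac2n h(\vec{\mathbf X})}\ =\ \frac{n}{(n!)^{2/n}}.$$ Moreover, as $n\to\infty$, $$\frac{n}{(n!)^{2/n}}\Big/ \frac{1}{n^{(n+1)/n}}\ \longrightarrow\ \mathrm e^2 .$$ The bound $n/(n!)^{2/n}$ is nonincreasing in $n\ge 1$, strictly decreasing in $n\ge 2$, and tends to $0$ as $n\to\infty$. It does not scale correctly with $n$: its ratio to $\mathsf{Var}(\vec{\mathbf X})$ tends to $0$ as $n\to\infty$. -/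

import Mathlib

open MeasureTheory ProbabilityTheory Filter Topology
open scoped Nat

noncomputable section

/-- The vector `x ∈ ℝⁿ` with its entries rearranged in ascending order. -/
def sortVec {n : ℕ} (x : EuclideanSpace ℝ (Fin n)) : EuclideanSpace ℝ (Fin n) :=
  WithLp.toLp 2 (fun i => x (Tuple.sort (fun j => x j) i))

/-- The minimum mean square error `E[‖V - E[V | U]‖²]` of estimating `V` from `U`, where
`E[V | U]` is the conditional expectation of `V` given the σ-algebra generated by `U`. -/
def mmse {Ω E F : Type*} [MeasurableSpace Ω] [NormedAddCommGroup E] [NormedSpace ℝ E]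
    [CompleteSpace E] [MeasurableSpace F] (V : Ω → E) (U : Ω → F) (P : Measure Ω) : ℝ :=
  ∫ ω, ‖V ω - (P[V | MeasurableSpace.comap U inferInstance]) ω‖ ^ 2 ∂P

/-- The variance `E[‖V - E[V]‖²]` of a random vector. -/
def vecVar {Ω E : Type*} [MeasurableSpace Ω] [NormedAddCommGroup E] [NormedSpace ℝ E]
    (V : Ω → E) (P : Measure Ω) : ℝ :=
  ∫ ω, ‖V ω - ∫ ω', V ω' ∂P‖ ^ 2 ∂P

/-- The integrand `-f log f` of the differential entropy of `μ`,
where `f` is the Lebesgue density of `μ`. -/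
def entropyDensity {n : ℕ} (μ : Measure (EuclideanSpace ℝ (Fin n)))
    (x : EuclideanSpace ℝ (Fin n)) : ℝ :=
  Real.negMulLog (μ.rnDeriv volume x).toReal

/-- The differential entropy `h(V) = -∫ f log f` of a random vector `V` in `ℝⁿ`,
where `f` is the Lebesgue density of the law of `V`; meaningful
when that law is absolutely continuous and `f log f` is integrable. -/
def diffEntropy {Ω : Type*} [MeasurableSpace Ω] {n : ℕ} (V : Ω → EuclideanSpace ℝ (Fin n))
    (P : Measure Ω) : ℝ :=
  ∫ x, entropyDensity (P.map V) x

/-- `Y` is the output of the Gaussian channel with noise variance `σ²` and input `X`: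
given `X = x`, the random vector `Y` has law `N(x, σ² Iₙ)`. -/
def IsGaussianChannel {Ω : Type*} [MeasurableSpace Ω] {n : ℕ} (σ : ℝ)
    (X Y : Ω → EuclideanSpace ℝ (Fin n)) (P : Measure Ω) [IsFiniteMeasure P] : Prop :=
  Measurable Y ∧
    ∀ᵐ x ∂(P.map X), condDistrib Y X P x =
      multivariateGaussian x (σ ^ 2 • (1 : Matrix (Fin n) (Fin n) ℝ))

/-- The number `n / (n!)^(2/n)`. -/
def entropyVarBound (n : ℕ) : ℝ := n / (n ! : ℝ) ^ (2 / (n : ℝ))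

end

/-! Everything rests on one estimate: for standard Gaussian `z` and any fixed `m`, `c`, the mean of
`‖sortVec (m + z) - c‖²` is at least `n / (n!)^(2/n)` (`le_integral_sq_norm_sortVec_add_sub`). It is
proved without conditional entropies. Against the Gaussian density, the factor `exp (‖z‖²/2)` leaves
Lebesgue measure, sorting costs at most a factor `n!`, and with weight `b = (n!)^(2/n)` the
exponential moment of `‖z‖²/2 - b/2 * ‖sortVec (m + z) - c‖²` is at most `1`. Since `1 + t ≤ exp t`,
that difference has nonpositive mean.

A rotation of Gaussian space writes the channel, with `r = √(1 + σ²)`, as `X = V/r + (σ/r) W` and `Y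
= r V` with `V`, `W` independent standard Gaussians (`exists_map_eq_stdGaussian_prod`). This gives
`mmse X Y P` exactly. Any estimate based on the sorted output is a function of `V`, so freezing `V`
and rescaling the estimate above by `σ/r` gives the bound for the sorted vectors. For `σ → ∞`,
sorting is 1-Lipschitz by the rearrangement inequality, so `sortVec X` is close in mean square to
`sortVec ((σ/r) W)`, which is independent of `V`.

The variance bound is the same estimate with `m = 0` and `c` the mean. The sorted vector has density
`n!` times the Gaussian one on the monotone cone, so its entropy is the Gaussian entropy minus `log
n!`, and the entropy expression equals `entropyVarBound n`. The asymptotics come from Stirling's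
formula. The bound has the wrong order because the variance stays at least `1`: sorting preserves
the sum of the entries. -/

/-- The density `(2π)^(-n/2) exp(-‖x‖²/2)` of the standard Gaussian law on `ℝⁿ`. -/
noncomputable def stdGaussianDensity {n : ℕ} (x : EuclideanSpace ℝ (Fin n)) : ℝ :=
  ((2 * Real.pi) ^ ((n : ℝ) / 2))⁻¹ * Real.exp (-(1 / 2) * ‖x‖ ^ 2)

/-! ### Density and second moments of the standard Gaussian law -/

section StdGaussian

variable {n : ℕ}

lemma stdGaussianDensity_pos (x : EuclideanSpace ℝ (Fin n)) : 0 < stdGaussianDensity x := by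
  unfold stdGaussianDensity; positivity

@[fun_prop]
lemma continuous_stdGaussianDensity :
    Continuous (stdGaussianDensity : EuclideanSpace ℝ (Fin n) → ℝ) := by
  unfold stdGaussianDensity; fun_prop

@[fun_prop]
lemma measurable_stdGaussianDensity :
    Measurable (stdGaussianDensity : EuclideanSpace ℝ (Fin n) → ℝ) :=
  continuous_stdGaussianDensity.measurable

lemma integral_exp_neg_mul_sq_norm {b : ℝ} (hb : 0 < b) :
    ∫ x : EuclideanSpace ℝ (Fin n), Real.exp (-b * ‖x‖ ^ 2) = (Real.pi / b) ^ ((n : ℝ) / 2) := by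
  simpa using GaussianFourier.integral_rexp_neg_mul_sq_norm (V := EuclideanSpace ℝ (Fin n)) hb

lemma integrable_exp_neg_mul_sq_norm {b : ℝ} (hb : 0 < b) :
    Integrable fun x : EuclideanSpace ℝ (Fin n) => Real.exp (-b * ‖x‖ ^ 2) := by
  refine Integrable.of_integral_ne_zero ?_
  rw [integral_exp_neg_mul_sq_norm hb]
  positivity

lemma integral_stdGaussianDensity :
    ∫ x : EuclideanSpace ℝ (Fin n), stdGaussianDensity x = 1 := by
  simp only [stdGaussianDensity]
  rw [integral_const_mul, integral_exp_neg_mul_sq_norm (by norm_num)]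
  rw [show Real.pi / (1 / 2) = 2 * Real.pi by ring]
  exact inv_mul_cancel₀ (by positivity)

lemma integrable_stdGaussianDensity :
    Integrable (stdGaussianDensity : EuclideanSpace ℝ (Fin n) → ℝ) :=
  (integrable_exp_neg_mul_sq_norm (by norm_num)).const_mul _

instance isProbabilityMeasure_withDensity_stdGaussianDensity :
    IsProbabilityMeasure ((volume : Measure (EuclideanSpace ℝ (Fin n))).withDensity
      fun x => ENNReal.ofReal (stdGaussianDensity x)) := by
  constructor
  rw [withDensity_apply _ MeasurableSet.univ, Measure.restrict_univ,
    ← ofReal_integral_eq_lintegral_ofReal integrable_stdGaussianDensity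
      (ae_of_all _ fun x => (stdGaussianDensity_pos x).le), integral_stdGaussianDensity,
    ENNReal.ofReal_one]

/-- Both sides are finite measures, so it suffices to match characteristic functions; that of the
density is the complex Gaussian integral with linear coefficient `i`. -/
lemma stdGaussian_eq_withDensity :
    stdGaussian (EuclideanSpace ℝ (Fin n)) =
      volume.withDensity fun x => ENNReal.ofReal (stdGaussianDensity x) := by
  apply Measure.ext_of_charFun
  ext t
  rw [charFun_stdGaussian, charFun_apply,
    integral_withDensity_eq_integral_toReal_smul (by fun_prop) (by simp)]
  have h := GaussianFourier.integral_cexp_neg_mul_sq_norm_add (V := EuclideanSpace ℝ (Fin n))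
    (b := (1 / 2 : ℂ)) (by norm_num) Complex.I t
  have h2 : ∀ x : EuclideanSpace ℝ (Fin n),
      (ENNReal.ofReal (stdGaussianDensity x)).toReal • Complex.exp ((inner ℝ x t : ℝ) * Complex.I)
      = ((((2 * Real.pi) ^ ((n : ℝ) / 2))⁻¹ : ℝ) : ℂ) *
        Complex.exp (-(1 / 2 : ℂ) * (‖x‖ : ℂ) ^ 2 + Complex.I * ((inner ℝ t x : ℝ) : ℂ)) := by
    intro x
    rw [ENNReal.toReal_ofReal (stdGaussianDensity_pos x).le, stdGaussianDensity, Complex.exp_add,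
      Complex.real_smul, real_inner_comm]
    push_cast
    ring_nf
  simp_rw [h2]
  rw [integral_const_mul, h, finrank_euclideanSpace_fin]
  have h3 : ((Real.pi : ℂ) / (1 / 2)) ^ ((n : ℂ) / 2) = (((2 * Real.pi) ^ ((n : ℝ) / 2) : ℝ) : ℂ) := by
    rw [Complex.ofReal_cpow (by positivity)]
    push_cast
    ring_nf
  rw [h3, ← mul_assoc, ← Complex.ofReal_mul, inv_mul_cancel₀ (by positivity), Complex.ofReal_one,
    one_mul, Complex.I_sq]
  congr 1
  ring

lemma stdGaussian_absolutelyContinuous :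
    stdGaussian (EuclideanSpace ℝ (Fin n)) ≪ volume := by
  rw [stdGaussian_eq_withDensity]
  exact withDensity_absolutelyContinuous _ _

lemma memLp_id_stdGaussian : MemLp id 2 (stdGaussian (EuclideanSpace ℝ (Fin n))) :=
  IsGaussian.memLp_two_id

lemma integrable_sq_norm_stdGaussian :
    Integrable (fun x => ‖x‖ ^ 2) (stdGaussian (EuclideanSpace ℝ (Fin n))) :=
  memLp_id_stdGaussian.integrable_norm_pow (by norm_num)

lemma covariance_eval_stdGaussian (i j : Fin n) :
    cov[fun x => x i, fun x => x j; stdGaussian (EuclideanSpace ℝ (Fin n))] =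
      (1 : Matrix (Fin n) (Fin n) ℝ) i j := by
  rw [← multivariateGaussian_zero_one]
  exact covariance_eval_multivariateGaussian Matrix.PosSemidef.one i j

lemma memLp_eval_stdGaussian (i : Fin n) :
    MemLp (fun x : EuclideanSpace ℝ (Fin n) => x i) 2 (stdGaussian (EuclideanSpace ℝ (Fin n))) :=
  memLp_id_stdGaussian.continuousLinearMap_comp (EuclideanSpace.proj i : _ →L[ℝ] ℝ)

lemma integral_eval_stdGaussian (i : Fin n) :
    ∫ x : EuclideanSpace ℝ (Fin n), x i ∂stdGaussian _ = 0 :=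
  integral_strongDual_stdGaussian (EuclideanSpace.proj i : EuclideanSpace ℝ (Fin n) →L[ℝ] ℝ)

lemma integral_eval_mul_eval_stdGaussian (i j : Fin n) :
    ∫ x : EuclideanSpace ℝ (Fin n), x i * x j ∂stdGaussian _ =
      (1 : Matrix (Fin n) (Fin n) ℝ) i j := by
  have h := covariance_eq_sub (memLp_eval_stdGaussian i) (memLp_eval_stdGaussian j)
  rw [covariance_eval_stdGaussian, integral_eval_stdGaussian, zero_mul, sub_zero] at h
  exact h.symm

lemma integral_sq_norm_stdGaussian :
    ∫ x, ‖x‖ ^ 2 ∂stdGaussian (EuclideanSpace ℝ (Fin n)) = n := by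
  simp_rw [EuclideanSpace.real_norm_sq_eq]
  rw [integral_finsetSum _ fun i _ => (memLp_eval_stdGaussian i).integrable_sq]
  simp [sq, integral_eval_mul_eval_stdGaussian]

lemma integral_sq_sum_stdGaussian :
    ∫ x : EuclideanSpace ℝ (Fin n), (∑ i, x i) ^ 2 ∂stdGaussian _ = n := by
  have h (i j : Fin n) : Integrable (fun x : EuclideanSpace ℝ (Fin n) => x i * x j)
      (stdGaussian (EuclideanSpace ℝ (Fin n))) :=
    (memLp_eval_stdGaussian i).integrable_mul (memLp_eval_stdGaussian j)
  simp_rw [sq, Finset.sum_mul_sum]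
  rw [integral_finsetSum _ fun i _ => integrable_finsetSum _ fun j _ => h i j]
  simp_rw [integral_finsetSum _ fun j _ => h _ j]
  simp [integral_eval_mul_eval_stdGaussian, Matrix.one_apply]

end StdGaussian

/-! ### Sorting as a 1-Lipschitz map -/

section Sorting

variable {n : ℕ}

/-- The isometry of `ℝⁿ` that permutes the entries of a vector. -/
noncomputable def permIso (π : Equiv.Perm (Fin n)) :
    EuclideanSpace ℝ (Fin n) ≃ₗᵢ[ℝ] EuclideanSpace ℝ (Fin n) :=
  LinearIsometryEquiv.piLpCongrLeft 2 ℝ ℝ π.symm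

@[simp]
lemma permIso_apply (π : Equiv.Perm (Fin n)) (x : EuclideanSpace ℝ (Fin n)) (i : Fin n) :
    permIso π x i = x (π i) := by
  simp [permIso, LinearIsometryEquiv.piLpCongrLeft_apply]

lemma sortVec_apply (x : EuclideanSpace ℝ (Fin n)) (i : Fin n) :
    sortVec x i = x (Tuple.sort (fun j => x j) i) := rfl

lemma sortVec_eq_permIso (x : EuclideanSpace ℝ (Fin n)) :
    sortVec x = permIso (Tuple.sort fun j => x j) x := by
  ext i; simp [sortVec_apply]

lemma monotone_sortVec (x : EuclideanSpace ℝ (Fin n)) : Monotone fun i => sortVec x i :=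
  Tuple.monotone_sort fun j => x j

/-- Ties make the sorting permutation ambiguous but not the sorted vector, so monotonicity alone
identifies it. -/
lemma permIso_eq_sortVec {x : EuclideanSpace ℝ (Fin n)} {π : Equiv.Perm (Fin n)}
    (h : Monotone fun i => permIso π x i) : permIso π x = sortVec x := by
  have h' : Monotone ((fun j => x j) ∘ π) := by simpa [Function.comp_def] using h
  have := Tuple.comp_sort_eq_comp_iff_monotone.2 h'
  ext i
  rw [permIso_apply]
  exact congrFun this i

lemma sortVec_smul {c : ℝ} (hc : 0 ≤ c) (x : EuclideanSpace ℝ (Fin n)) :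
    sortVec (c • x) = c • sortVec x := by
  rw [sortVec_eq_permIso x, ← map_smul, eq_comm]
  apply permIso_eq_sortVec
  intro i j hij
  have := monotone_sortVec x hij
  simp only [sortVec_apply] at this
  simpa using mul_le_mul_of_nonneg_left this hc

@[simp]
lemma norm_sortVec (x : EuclideanSpace ℝ (Fin n)) : ‖sortVec x‖ = ‖x‖ := by
  rw [sortVec_eq_permIso, LinearIsometryEquiv.norm_map]

lemma sum_sortVec (x : EuclideanSpace ℝ (Fin n)) : ∑ i, sortVec x i = ∑ i, x i :=
  Equiv.sum_comp (Tuple.sort fun j => x j) fun j => x j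

/-- The rearrangement inequality: a sum of products is largest when both families are ordered alike.
-/
lemma inner_le_inner_sortVec (x y : EuclideanSpace ℝ (Fin n)) :
    inner ℝ x y ≤ inner ℝ (sortVec x) (sortVec y) := by
  have hm : Monovary (fun i => sortVec y i) (fun i => sortVec x i) := fun i j hij =>
    monotone_sortVec y ((monotone_sortVec x).reflect_lt hij).le
  set σ := Tuple.sort fun j => x j
  set τ := Tuple.sort fun j => y j
  have h := hm.sum_mul_comp_perm_le_sum_mul (σ := τ.trans σ.symm)
  simp only [PiLp.inner_apply, RCLike.inner_apply, conj_trivial]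
  refine le_trans (le_of_eq ?_) h
  rw [← Equiv.sum_comp τ]
  refine Finset.sum_congr rfl fun i _ => ?_
  simp [sortVec_apply, σ, τ]

/-- In the expansion of the square, sorting keeps both norms and can only increase the inner
product. -/
lemma norm_sortVec_sub_sortVec_le (x y : EuclideanSpace ℝ (Fin n)) :
    ‖sortVec x - sortVec y‖ ≤ ‖x - y‖ := by
  refine le_of_sq_le_sq ?_ (norm_nonneg _)
  rw [norm_sub_sq_real, norm_sub_sq_real, norm_sortVec, norm_sortVec]
  linarith [inner_le_inner_sortVec x y]

lemma lipschitzWith_sortVec :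
    LipschitzWith 1 (sortVec : EuclideanSpace ℝ (Fin n) → EuclideanSpace ℝ (Fin n)) :=
  LipschitzWith.of_dist_le_mul fun x y => by
    simpa [dist_eq_norm] using norm_sortVec_sub_sortVec_le x y

@[fun_prop]
lemma continuous_sortVec :
    Continuous (sortVec : EuclideanSpace ℝ (Fin n) → EuclideanSpace ℝ (Fin n)) :=
  lipschitzWith_sortVec.continuous

@[fun_prop]
lemma measurable_sortVec :
    Measurable (sortVec : EuclideanSpace ℝ (Fin n) → EuclideanSpace ℝ (Fin n)) :=
  continuous_sortVec.measurable

lemma MeasureTheory.MemLp.sortVec {Ω : Type*} [MeasurableSpace Ω] {P : Measure Ω}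
    {p : ENNReal} {V : Ω → EuclideanSpace ℝ (Fin n)} (hV : MemLp V p P) :
    MemLp (fun ω => _root_.sortVec (V ω)) p P :=
  hV.of_le (continuous_sortVec.comp_aestronglyMeasurable hV.1) (by simp)

/-- The sorted vector is one of the `n!` permuted vectors, so its term is dominated by the sum over
all permutations, each of which preserves Lebesgue measure. -/
lemma lintegral_comp_sortVec_le {F : EuclideanSpace ℝ (Fin n) → ENNReal} (hF : Measurable F) :
    ∫⁻ x, F (sortVec x) ≤ n ! * ∫⁻ x, F x := by
  calc ∫⁻ x, F (sortVec x) ≤ ∫⁻ x, ∑ π : Equiv.Perm (Fin n), F (permIso π x) := by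
        refine lintegral_mono fun x => ?_
        rw [sortVec_eq_permIso]
        exact Finset.single_le_sum (f := fun π => F (permIso π x)) (fun _ _ => zero_le)
          (Finset.mem_univ _)
    _ = ∑ π : Equiv.Perm (Fin n), ∫⁻ x, F x := by
        have h (π : Equiv.Perm (Fin n)) : Measurable fun x => F (permIso π x) :=
          hF.comp (permIso π).continuous.measurable
        rw [lintegral_finsetSum _ fun π _ => h π]
        exact Finset.sum_congr rfl fun π _ => (permIso π).measurePreserving.lintegral_comp hF
    _ = n ! * ∫⁻ x, F x := by
        simp [Fintype.card_perm]

end Sorting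

/-! ### Lower bounds for the spread of a sorted Gaussian vector -/

section SortedGaussian

variable {n : ℕ}

lemma factorial_rpow_two_div_pos (n : ℕ) : 0 < (n ! : ℝ) ^ (2 / (n : ℝ)) :=
  Real.rpow_pos_of_pos (mod_cast n.factorial_pos) _

lemma memLp_sortVec_add_sub (m c : EuclideanSpace ℝ (Fin n)) :
    MemLp (fun z => sortVec (m + z) - c) 2 (stdGaussian (EuclideanSpace ℝ (Fin n))) :=
  (((memLp_const m).add memLp_id_stdGaussian).sortVec).sub (memLp_const c)

lemma lintegral_exp_neg_mul_sq_norm_sub {b : ℝ} (hb : 0 < b) (c : EuclideanSpace ℝ (Fin n)) :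
    ∫⁻ x, ENNReal.ofReal (Real.exp (-b * ‖x - c‖ ^ 2)) =
      ENNReal.ofReal ((Real.pi / b) ^ ((n : ℝ) / 2)) := by
  rw [lintegral_sub_right_eq_self (fun x => ENNReal.ofReal (Real.exp (-b * ‖x‖ ^ 2))),
    ← ofReal_integral_eq_lintegral_ofReal (integrable_exp_neg_mul_sq_norm hb)
      (ae_of_all _ fun _ => (Real.exp_pos _).le), integral_exp_neg_mul_sq_norm hb]

/-- The term `‖z‖²/2` cancels the Gaussian weight, so the shift by `m` is absorbed by translation
invariance. The exponent `2/n` is chosen so that the Gaussian integral supplies `1/n!`, exactly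
offsetting the cost of sorting. -/
lemma lintegral_exp_sq_norm_sub_sq_norm_sortVec_le (hn : n ≠ 0)
    (m c : EuclideanSpace ℝ (Fin n)) :
    ∫⁻ z, ENNReal.ofReal (Real.exp (‖z‖ ^ 2 / 2 -
      (n ! : ℝ) ^ (2 / (n : ℝ)) / 2 * ‖sortVec (m + z) - c‖ ^ 2)) ∂stdGaussian _ ≤ 1 := by
  set b : ℝ := (n ! : ℝ) ^ (2 / (n : ℝ)) with hb
  have hb0 : 0 < b := factorial_rpow_two_div_pos n
  set K : ℝ := ((2 * Real.pi) ^ ((n : ℝ) / 2))⁻¹ with hK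
  have hK0 : 0 < K := by positivity
  set G : EuclideanSpace ℝ (Fin n) → ENNReal :=
    fun x => ENNReal.ofReal (Real.exp (-(b / 2) * ‖x - c‖ ^ 2)) with hG
  have hGm : Measurable G := by fun_prop
  rw [stdGaussian_eq_withDensity, lintegral_withDensity_eq_lintegral_mul _ (by fun_prop)
    (by fun_prop)]
  calc _ = ∫⁻ z, ENNReal.ofReal K * G (sortVec (m + z)) := by
        refine lintegral_congr fun z => ?_
        simp only [Pi.mul_apply, hG]
        rw [← ENNReal.ofReal_mul (stdGaussianDensity_pos z).le, ← ENNReal.ofReal_mul hK0.le,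
          stdGaussianDensity, ← hK, mul_assoc, ← Real.exp_add]
        ring_nf
    _ = ENNReal.ofReal K * ∫⁻ x, G (sortVec x) := by
        rw [lintegral_const_mul _ (by fun_prop),
          lintegral_add_left_eq_self (fun z => G (sortVec z)) m]
    _ ≤ ENNReal.ofReal K * (n ! * ∫⁻ x, G x) := by
        gcongr
        exact lintegral_comp_sortVec_le hGm
    _ = 1 := by
        have hbn : b ^ ((n : ℝ) / 2) = n ! := by
          rw [hb, ← Real.rpow_mul (by positivity)]
          have : (n : ℝ) ≠ 0 := mod_cast hn
          field_simp
          simp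
        rw [hG, lintegral_exp_neg_mul_sq_norm_sub (by positivity),
          ← ENNReal.ofReal_natCast, ← ENNReal.ofReal_mul (by positivity),
          ← ENNReal.ofReal_mul hK0.le, ← ENNReal.ofReal_one,
          show Real.pi / (b / 2) = (2 * Real.pi) / b by field_simp,
          Real.div_rpow (by positivity) hb0.le, hbn, hK]
        congr 1
        field_simp

lemma le_integral_sq_norm_sortVec_add_sub (m c : EuclideanSpace ℝ (Fin n)) :
    n / (n ! : ℝ) ^ (2 / (n : ℝ)) ≤ ∫ z, ‖sortVec (m + z) - c‖ ^ 2 ∂stdGaussian _ := by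
  rcases eq_or_ne n 0 with rfl | hn
  · simp only [CharP.cast_eq_zero, zero_div]
    positivity
  set b : ℝ := (n ! : ℝ) ^ (2 / (n : ℝ)) with hb
  have hb0 : 0 < b := factorial_rpow_two_div_pos n
  set S : EuclideanSpace ℝ (Fin n) → ℝ :=
    fun z => ‖z‖ ^ 2 / 2 - b / 2 * ‖sortVec (m + z) - c‖ ^ 2 with hS
  have hle := lintegral_exp_sq_norm_sub_sq_norm_sortVec_le hn m c
  have hi1 := (integrable_sq_norm_stdGaussian (n := n)).div_const 2
  have hi2 := ((memLp_sortVec_add_sub m c).integrable_norm_pow (by norm_num)).const_mul (b / 2)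
  have hSi : Integrable S (stdGaussian _) := hi1.sub hi2
  have hEi : Integrable (fun z => Real.exp (S z)) (stdGaussian (EuclideanSpace ℝ (Fin n))) := by
    refine ⟨(by fun_prop), ?_⟩
    rw [hasFiniteIntegral_iff_ofReal (ae_of_all _ fun _ => (Real.exp_pos _).le)]
    exact hle.trans_lt ENNReal.one_lt_top
  have hE : ∫ z, Real.exp (S z) ∂stdGaussian (EuclideanSpace ℝ (Fin n)) ≤ 1 := by
    rw [integral_eq_lintegral_of_nonneg_ae (ae_of_all _ fun _ => (Real.exp_pos _).le) hEi.1]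
    exact ENNReal.toReal_le_of_le_ofReal one_pos.le (by simpa using hle)
  -- The tangent line inequality `S + 1 ≤ exp S` plays the role of Jensen's inequality and yields `∫
  -- S ≤ 0`.
  have h1 : ∫ z, (S z + 1) ∂stdGaussian (EuclideanSpace ℝ (Fin n)) ≤ 1 :=
    (integral_mono (hSi.add (integrable_const 1)) hEi fun z => Real.add_one_le_exp _).trans hE
  rw [integral_add hSi (integrable_const 1), integral_sub hi1 hi2, integral_div,
    integral_const_mul, integral_sq_norm_stdGaussian] at h1
  simp only [integral_const, probReal_univ, smul_eq_mul, mul_one] at h1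
  rw [div_le_iff₀' hb0]
  linarith

/-- Sorting commutes with positive scaling, so `s` can be factored out of the norm. -/
lemma le_integral_sq_norm_sortVec_add_smul_sub {s : ℝ} (hs : 0 < s)
    (m c : EuclideanSpace ℝ (Fin n)) :
    s ^ 2 * (n / (n ! : ℝ) ^ (2 / (n : ℝ))) ≤
      ∫ z, ‖sortVec (m + s • z) - c‖ ^ 2 ∂stdGaussian _ := by
  have h (z : EuclideanSpace ℝ (Fin n)) : ‖sortVec (m + s • z) - c‖ ^ 2 =
      s ^ 2 * ‖sortVec (s⁻¹ • m + z) - s⁻¹ • c‖ ^ 2 := by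
    have : m + s • z = s • (s⁻¹ • m + z) := by rw [smul_add, smul_inv_smul₀ hs.ne']
    rw [this, sortVec_smul hs.le, show s • sortVec (s⁻¹ • m + z) - c =
      s • (sortVec (s⁻¹ • m + z) - s⁻¹ • c) by rw [smul_sub, smul_inv_smul₀ hs.ne'],
      norm_smul, mul_pow, Real.norm_eq_abs, sq_abs]
  simp_rw [h]
  rw [integral_const_mul]
  gcongr
  exact le_integral_sq_norm_sortVec_add_sub _ _

lemma vecVar_map {Ω Ω' E : Type*} [MeasurableSpace Ω] [MeasurableSpace Ω']
    [NormedAddCommGroup E] [NormedSpace ℝ E] {P : Measure Ω} {X : Ω → Ω'} {V : Ω' → E}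
    (hX : AEMeasurable X P) (hV : AEStronglyMeasurable V (P.map X)) :
    vecVar (fun ω => V (X ω)) P = vecVar V (P.map X) := by
  rw [vecVar, vecVar, ← integral_map hX hV]
  exact (integral_map hX (f := fun x => ‖V x - ∫ y, V y ∂P.map X‖ ^ 2)
    ((hV.sub aestronglyMeasurable_const).norm.pow 2)).symm

lemma entropyVarBound_le_vecVar_sortVec :
    entropyVarBound n ≤ vecVar sortVec (stdGaussian (EuclideanSpace ℝ (Fin n))) := by
  have h := le_integral_sq_norm_sortVec_add_sub (n := n) 0 (∫ z, sortVec z ∂stdGaussian _)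
  simpa [vecVar, entropyVarBound] using h

/-- By the Cauchy–Schwarz inequality, the variance of the sum of the entries, which sorting
preserves, is at most `n` times the variance of the sorted vector. -/
lemma one_le_vecVar_sortVec (hn : n ≠ 0) :
    1 ≤ vecVar sortVec (stdGaussian (EuclideanSpace ℝ (Fin n))) := by
  set c := ∫ z, sortVec z ∂stdGaussian (EuclideanSpace ℝ (Fin n)) with hc
  have hL : MemLp sortVec 2 (stdGaussian (EuclideanSpace ℝ (Fin n))) :=
    memLp_id_stdGaussian.sortVec
  -- Sorting preserves the sum of the entries, so the centre inherits the zero mean of the Gaussian.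
  have hcs : ∑ i, c i = 0 := by
    have h1 (i : Fin n) : c i = ∫ z, sortVec z i ∂stdGaussian (EuclideanSpace ℝ (Fin n)) :=
      ((EuclideanSpace.proj i : EuclideanSpace ℝ (Fin n) →L[ℝ] ℝ).integral_comp_comm
        (hL.integrable (by norm_num))).symm
    have h2 (i : Fin n) : Integrable (fun z => sortVec z i)
        (stdGaussian (EuclideanSpace ℝ (Fin n))) :=
      (hL.continuousLinearMap_comp (EuclideanSpace.proj i : _ →L[ℝ] ℝ)).integrable (by norm_num)
    simp_rw [h1]
    rw [← integral_finsetSum _ fun i _ => h2 i]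
    simp_rw [sum_sortVec]
    rw [integral_finsetSum _ fun i _ => (memLp_eval_stdGaussian i).integrable (by norm_num)]
    simp [integral_eval_stdGaussian]
  have hle : ∫ z : EuclideanSpace ℝ (Fin n), (∑ i, z i) ^ 2 ∂stdGaussian _ ≤
      ∫ z, n * ‖sortVec z - c‖ ^ 2 ∂stdGaussian (EuclideanSpace ℝ (Fin n)) := by
    refine integral_mono_of_nonneg (ae_of_all _ fun _ => sq_nonneg _)
      (((hL.sub (memLp_const c)).integrable_norm_pow (by norm_num)).const_mul _)
      (ae_of_all _ fun z => ?_)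
    have h := sq_sum_le_card_mul_sum_sq (s := Finset.univ) (f := fun i => (sortVec z - c) i)
    rw [← EuclideanSpace.real_norm_sq_eq] at h
    simpa [Finset.sum_sub_distrib, sum_sortVec, hcs] using h
  rw [integral_sq_sum_stdGaussian, integral_const_mul] at hle
  have hn' : (0 : ℝ) < n := by positivity
  exact le_of_mul_le_mul_left (by simpa [vecVar] using hle) hn'

end SortedGaussian

/-! ### Monotonicity and asymptotics of the bound -/

section Asymptotics

lemma entropyVarBound_pos {n : ℕ} (hn : n ≠ 0) : 0 < entropyVarBound n := by
  have := factorial_rpow_two_div_pos n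
  unfold entropyVarBound; positivity

lemma log_entropyVarBound {n : ℕ} (hn : n ≠ 0) :
    Real.log (entropyVarBound n) = Real.log n - 2 / n * Real.log n ! := by
  have h : (0 : ℝ) < n ! := mod_cast n.factorial_pos
  rw [entropyVarBound, Real.log_div (by positivity) (factorial_rpow_two_div_pos n).ne',
    Real.log_rpow h]

/-- Summation by parts. It prepares the comparison of a weighted sum of decreasing increments with
their last value. -/
lemma mul_log_succ_sub_log_factorial (n : ℕ) :
    n * Real.log (n + 1) - Real.log n ! =
      ∑ k ∈ Finset.range n, ((k : ℝ) + 1) * (Real.log (k + 2) - Real.log (k + 1)) := by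
  induction n with
  | zero => simp
  | succ n ih =>
    rw [Finset.sum_range_succ, ← ih, Nat.factorial_succ, Nat.cast_mul,
      Real.log_mul (by positivity) (by positivity)]
    push_cast
    ring_nf

lemma log_add_two_sub_log_add_one_strictAnti {x y : ℝ} (hx : 0 ≤ x) (hxy : x < y) :
    Real.log (y + 2) - Real.log (y + 1) < Real.log (x + 2) - Real.log (x + 1) := by
  have hy : 0 ≤ y := hx.trans hxy.le
  rw [← Real.log_div (by positivity) (by positivity), ← Real.log_div (by positivity) (by positivity)]
  apply Real.log_lt_log (by positivity)
  rw [div_lt_div_iff₀ (by positivity) (by positivity)]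
  nlinarith

lemma sum_range_cast_add_one (n : ℕ) :
    ∑ k ∈ Finset.range n, ((k : ℝ) + 1) = n * (n + 1) / 2 := by
  induction n with
  | zero => simp
  | succ n ih => rw [Finset.sum_range_succ, ih]; push_cast; ring

/-- Up to the factor `2/(n(n+1))`, the drop in the logarithm is `∑ (k+1) (d k - d (n-1))` over `k <
n`, where `d k = log (k+2) - log (k+1)` decreases. The term `k = 0` is strictly positive as soon as
`n ≥ 2`. -/
lemma entropyVarBound_succ_lt {n : ℕ} (hn : 2 ≤ n) :
    entropyVarBound (n + 1) < entropyVarBound n := by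
  have hn0 : (0 : ℝ) < n := by positivity
  rw [← Real.log_lt_log_iff (entropyVarBound_pos (by lia)) (entropyVarBound_pos (by lia)),
    log_entropyVarBound (by lia), log_entropyVarBound (by lia), Nat.factorial_succ, Nat.cast_mul,
    Real.log_mul (by positivity) (by positivity)]
  have key : n * (n + 1) / 2 * (Real.log (n + 1) - Real.log n) <
      n * Real.log (n + 1) - Real.log n ! := by
    rw [mul_log_succ_sub_log_factorial, ← sum_range_cast_add_one, Finset.sum_mul]
    obtain ⟨m, rfl⟩ : ∃ m, n = m + 2 := ⟨n - 2, by lia⟩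
    have h (k : ℕ) (hk : k < m + 1) : Real.log ((m + 2 : ℕ) + 1) - Real.log (m + 2 : ℕ) <
        Real.log (k + 2) - Real.log (k + 1) := by
      have := log_add_two_sub_log_add_one_strictAnti (x := k) (y := (m + 1 : ℕ)) (by positivity)
        (by exact_mod_cast hk)
      push_cast at this ⊢
      ring_nf at this ⊢
      exact this
    refine Finset.sum_lt_sum (fun k hk => ?_) ⟨0, by simp, ?_⟩
    -- The last index gives equality; all earlier ones are strict.
    · rcases (Nat.lt_succ_iff.1 (Finset.mem_range.1 hk)).lt_or_eq with hk | rfl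
      · exact mul_le_mul_of_nonneg_left (h k hk).le (by positivity)
      · push_cast
        ring_nf
        exact le_rfl
    · exact mul_lt_mul_of_pos_left (h 0 (by lia)) (by positivity)
  have e : Real.log n - 2 / n * Real.log n ! - (Real.log (n + 1) -
      2 / (n + 1) * (Real.log (n + 1) + Real.log n !)) =
      2 / (n * (n + 1)) * (n * Real.log (n + 1) - Real.log n ! -
        n * (n + 1) / 2 * (Real.log (n + 1) - Real.log n)) := by
    field_simp
    ring
  have : 0 < 2 / ((n : ℝ) * (n + 1)) * (n * Real.log (n + 1) - Real.log n ! -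
        n * (n + 1) / 2 * (Real.log (n + 1) - Real.log n)) :=
    mul_pos (by positivity) (sub_pos.2 key)
  push_cast
  linarith

lemma strictAntiOn_entropyVarBound : StrictAntiOn entropyVarBound (Set.Ici 2) := by
  intro a ha b _ hab
  induction b, hab using Nat.le_induction with
  | base => exact entropyVarBound_succ_lt ha
  | succ b hb ih =>
    exact (entropyVarBound_succ_lt (le_trans (Set.mem_Ici.1 ha) (by lia))).trans
      (ih (le_trans (Set.mem_Ici.1 ha) (by lia)))

lemma entropyVarBound_one : entropyVarBound 1 = 1 := by simp [entropyVarBound]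

lemma entropyVarBound_two : entropyVarBound 2 = 1 := by simp [entropyVarBound]

/-- The values at `1` and `2` coincide, so strictness can only begin at `2`. -/
lemma antitoneOn_entropyVarBound : AntitoneOn entropyVarBound (Set.Ici 1) := by
  intro a ha b hb hab
  rcases (Set.mem_Ici.1 ha).eq_or_lt with rfl | ha
  · rcases (Set.mem_Ici.1 hb).eq_or_lt with rfl | hb
    · exact le_rfl
    · rw [entropyVarBound_one, ← entropyVarBound_two]
      exact strictAntiOn_entropyVarBound.antitoneOn (Set.mem_Ici.2 le_rfl) hb hb
  · exact strictAntiOn_entropyVarBound.antitoneOn ha (le_trans (Set.mem_Ici.1 ha) hab) hab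

lemma tendsto_log_sub_log_factorial_div :
    Tendsto (fun n : ℕ => Real.log n - Real.log n ! / n) atTop (𝓝 1) := by
  have hs : Tendsto (fun n : ℕ => Real.log (Stirling.stirlingSeq n) / n) atTop (𝓝 0) :=
    (((Real.continuousAt_log (by positivity)).tendsto.comp
      Stirling.tendsto_stirlingSeq_sqrt_pi).div_atTop tendsto_natCast_atTop_atTop)
  have hl : Tendsto (fun n : ℕ => Real.log n / n) atTop (𝓝 0) := by
    have := (Real.isLittleO_log_id_atTop.tendsto_div_nhds_zero).comp
      (tendsto_natCast_atTop_atTop (R := ℝ))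
    simpa [Function.comp_def] using this
  have hc : Tendsto (fun n : ℕ => Real.log 2 / n) atTop (𝓝 0) :=
    tendsto_const_nhds.div_atTop tendsto_natCast_atTop_atTop
  have := ((hs.add ((hl.add hc).div_const 2)).const_sub 1)
  simp only [add_zero, zero_div, sub_zero] at this
  -- By the definition of the Stirling sequence, the quantity equals `1 - (log (stirlingSeq n) / n +
  -- (log n / n + log 2 / n) / 2)`.
  refine this.congr' ?_
  filter_upwards [eventually_ne_atTop 0] with n hn
  have hn0 : (0 : ℝ) < n := by positivity
  rw [Stirling.log_stirlingSeq_formula, Real.log_div (by positivity) (by positivity),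
    Real.log_mul (by positivity) (by positivity), Real.log_exp]
  field_simp
  ring

lemma tendsto_entropyVarBound_div :
    Tendsto (fun n : ℕ => entropyVarBound n / (1 / (n : ℝ) ^ (((n : ℝ) + 1) / n))) atTop
      (𝓝 (Real.exp 2)) := by
  have hl : Tendsto (fun n : ℕ => Real.log n / n) atTop (𝓝 0) := by
    have := (Real.isLittleO_log_id_atTop.tendsto_div_nhds_zero).comp
      (tendsto_natCast_atTop_atTop (R := ℝ))
    simpa [Function.comp_def] using this
  -- The logarithm of the ratio is `2 (log n - log n! / n) + log n / n`.
  have h := (Real.continuous_exp.tendsto _).comp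
    ((tendsto_log_sub_log_factorial_div.const_mul 2).add hl)
  simp only [mul_one, add_zero] at h
  refine h.congr' ?_
  filter_upwards [eventually_ne_atTop 0] with n hn
  have hn0 : (0 : ℝ) < n := by positivity
  rw [Function.comp_apply, Real.rpow_def_of_pos hn0, ← Real.exp_log (entropyVarBound_pos hn),
    log_entropyVarBound hn, one_div, ← Real.exp_neg, ← Real.exp_sub]
  congr 1
  field_simp
  ring

lemma tendsto_entropyVarBound_zero : Tendsto entropyVarBound atTop (𝓝 0) := by
  have h1 : Tendsto (fun n : ℕ => 1 / (n : ℝ) ^ (((n : ℝ) + 1) / n)) atTop (𝓝 0) := by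
    refine squeeze_zero' (Eventually.of_forall fun n => by positivity) ?_
      (tendsto_one_div_atTop_nhds_zero_nat (𝕜 := ℝ))
    filter_upwards [eventually_ge_atTop 1] with n hn
    have hn1 : (1 : ℝ) ≤ n := mod_cast hn
    refine one_div_le_one_div_of_le (by positivity) ?_
    calc (n : ℝ) = (n : ℝ) ^ (1 : ℝ) := (Real.rpow_one _).symm
      _ ≤ _ := Real.rpow_le_rpow_of_exponent_le hn1 (by rw [le_div_iff₀ (by positivity)]; linarith)
  have h := tendsto_entropyVarBound_div.mul h1
  rw [mul_zero] at h
  refine h.congr' ?_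
  filter_upwards [eventually_ne_atTop 0] with n hn
  have hn0 : (0 : ℝ) < n := by positivity
  exact div_mul_cancel₀ _ (by positivity)

lemma tendsto_entropyVarBound_div_vecVar :
    Tendsto (fun n : ℕ => entropyVarBound n /
      vecVar (sortVec : EuclideanSpace ℝ (Fin n) → EuclideanSpace ℝ (Fin n))
        (multivariateGaussian 0 (1 : Matrix (Fin n) (Fin n) ℝ))) atTop (𝓝 0) := by
  simp_rw [multivariateGaussian_zero_one]
  refine squeeze_zero' ?_ ?_ tendsto_entropyVarBound_zero
  · filter_upwards [eventually_ne_atTop 0] with n hn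
    exact div_nonneg (entropyVarBound_pos hn).le (zero_le_one.trans (one_le_vecVar_sortVec hn))
  · filter_upwards [eventually_ne_atTop 0] with n hn
    exact div_le_self (entropyVarBound_pos hn).le (one_le_vecVar_sortVec hn)

end Asymptotics

/-! ### Law and differential entropy of the sorted Gaussian vector -/

section Entropy

variable {n : ℕ}

/-- The closed cone of the vectors with entries in ascending order. -/
def monotoneCone (n : ℕ) : Set (EuclideanSpace ℝ (Fin n)) := {x | Monotone fun i => x i}

lemma measurableSet_monotoneCone : MeasurableSet (monotoneCone n) := by
  have : monotoneCone n = ⋂ i, ⋂ j, ⋂ (_ : i ≤ j), {x | x i ≤ x j} := by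
    ext x; simp [monotoneCone, Monotone]
  rw [this]
  exact MeasurableSet.iInter fun i => MeasurableSet.iInter fun j => MeasurableSet.iInter fun _ =>
    measurableSet_le (by fun_prop) (by fun_prop)

lemma ae_injective_stdGaussian :
    ∀ᵐ x ∂stdGaussian (EuclideanSpace ℝ (Fin n)), Function.Injective fun i => x i := by
  refine stdGaussian_absolutelyContinuous.ae_le ?_
  have h : ∀ i j : Fin n, i ≠ j → ∀ᵐ x : EuclideanSpace ℝ (Fin n), x i ≠ x j := by
    intro i j hij
    -- A tie between entries `i` and `j` means lying in the kernel of this nonzero functional, a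
    -- proper subspace and hence a null set.
    set L : EuclideanSpace ℝ (Fin n) →L[ℝ] ℝ := EuclideanSpace.proj i - EuclideanSpace.proj j
      with hL
    have hne : L.ker ≠ ⊤ := by
      intro h
      have : EuclideanSpace.single i (1 : ℝ) ∈ L.ker := by simp [h]
      simp [hL, hij.symm] at this
    have := Measure.addHaar_submodule volume L.ker hne
    rw [ae_iff]
    refine measure_mono_null (fun x hx => ?_) this
    simpa [hL, sub_eq_zero] using hx
  simp_rw [← ae_all_iff] at h
  filter_upwards [h] with x hx i j hij
  by_contra hne
  exact hx i j hne hij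

lemma map_permIso_stdGaussian (π : Equiv.Perm (Fin n)) :
    (stdGaussian (EuclideanSpace ℝ (Fin n))).map (permIso π) = stdGaussian _ :=
  stdGaussian_map (permIso π)

/-- The preimage of `A` under sorting is the union of the `n!` permuted copies of `A ∩ monotoneCone
n`. They have equal Gaussian mass and overlap only at vectors with ties. -/
lemma map_sortVec_stdGaussian :
    (stdGaussian (EuclideanSpace ℝ (Fin n))).map sortVec =
      (n ! : ENNReal) • (stdGaussian _).restrict (monotoneCone n) := by
  ext A hA
  have hB : MeasurableSet (A ∩ monotoneCone n) := hA.inter measurableSet_monotoneCone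
  have hunion : sortVec ⁻¹' A = ⋃ π : Equiv.Perm (Fin n), permIso π ⁻¹' (A ∩ monotoneCone n) := by
    ext x
    simp only [Set.mem_preimage, Set.mem_iUnion]
    constructor
    · intro hx
      refine ⟨Tuple.sort fun j => x j, ?_⟩
      rw [← sortVec_eq_permIso]
      exact ⟨hx, monotone_sortVec x⟩
    · rintro ⟨π, hx, hm⟩
      rwa [← permIso_eq_sortVec hm]
  have hmeas (π : Equiv.Perm (Fin n)) : MeasurableSet (permIso π ⁻¹' (A ∩ monotoneCone n)) :=
    (permIso π).continuous.measurable hB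
  have hdisj : Pairwise (Function.onFun (AEDisjoint (stdGaussian (EuclideanSpace ℝ (Fin n))))
      fun π : Equiv.Perm (Fin n) => permIso π ⁻¹' (A ∩ monotoneCone n)) := by
    intro π τ hne
    have hnull : stdGaussian (EuclideanSpace ℝ (Fin n))
        {x | ¬ Function.Injective fun i => x i} = 0 := ae_iff.1 ae_injective_stdGaussian
    refine measure_mono_null ?_ hnull
    intro x hx hinj
    apply hne
    have h := (permIso_eq_sortVec hx.1.2).trans (permIso_eq_sortVec hx.2.2).symm
    ext i
    have hi := congrArg (fun y => y i) h
    simp only [permIso_apply] at hi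
    exact congrArg Fin.val (hinj hi)
  rw [Measure.map_apply measurable_sortVec hA, hunion,
    measure_iUnion₀ hdisj fun π => (hmeas π).nullMeasurableSet, tsum_fintype]
  have (π : Equiv.Perm (Fin n)) : stdGaussian (EuclideanSpace ℝ (Fin n))
      (permIso π ⁻¹' (A ∩ monotoneCone n)) = stdGaussian _ (A ∩ monotoneCone n) := by
    conv_rhs => rw [← map_permIso_stdGaussian π]
    rw [Measure.map_apply (permIso π).continuous.measurable hB]
  rw [Finset.sum_congr rfl fun π _ => this π]
  simp [Measure.restrict_apply hA, Fintype.card_perm]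

/-- The density of the sorted standard Gaussian vector. -/
noncomputable def sortedGaussianDensity (x : EuclideanSpace ℝ (Fin n)) : ℝ :=
  (monotoneCone n).indicator (fun x => n ! * stdGaussianDensity x) x

lemma sortedGaussianDensity_nonneg (x : EuclideanSpace ℝ (Fin n)) :
    0 ≤ sortedGaussianDensity x :=
  Set.indicator_nonneg (fun x _ => by have := stdGaussianDensity_pos x; positivity) x

@[fun_prop]
lemma measurable_sortedGaussianDensity :
    Measurable (sortedGaussianDensity : EuclideanSpace ℝ (Fin n) → ℝ) :=
  Measurable.indicator (by fun_prop) measurableSet_monotoneCone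

lemma map_sortVec_stdGaussian_eq_withDensity :
    (stdGaussian (EuclideanSpace ℝ (Fin n))).map sortVec =
      volume.withDensity fun x => ENNReal.ofReal (sortedGaussianDensity x) := by
  rw [map_sortVec_stdGaussian, stdGaussian_eq_withDensity,
    restrict_withDensity measurableSet_monotoneCone, ← withDensity_indicator
      measurableSet_monotoneCone, ← withDensity_smul _ (by
        exact Measurable.indicator (by fun_prop) measurableSet_monotoneCone)]
  congr 1
  ext x
  by_cases hx : x ∈ monotoneCone n
  · simp [sortedGaussianDensity, hx, ENNReal.ofReal_mul]
  · simp [sortedGaussianDensity, hx]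

lemma map_sortVec_stdGaussian_absolutelyContinuous :
    (stdGaussian (EuclideanSpace ℝ (Fin n))).map sortVec ≪ volume := by
  rw [map_sortVec_stdGaussian_eq_withDensity]
  exact withDensity_absolutelyContinuous _ _

/-- On the cone the logarithm of the density is affine in `‖x‖²`; off it both sides vanish.
Factoring out the density turns the entropy integral into an expectation under the sorted law. -/
lemma entropyDensity_map_sortVec_stdGaussian :
    entropyDensity ((stdGaussian (EuclideanSpace ℝ (Fin n))).map sortVec) =ᵐ[volume]
      fun x => (ENNReal.ofReal (sortedGaussianDensity x)).toReal •
        (-Real.log n ! + n / 2 * Real.log (2 * Real.pi) + ‖x‖ ^ 2 / 2) := by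
  have h := Measure.rnDeriv_withDensity (volume : Measure (EuclideanSpace ℝ (Fin n)))
    (f := fun x => ENNReal.ofReal (sortedGaussianDensity x)) (by fun_prop)
  rw [map_sortVec_stdGaussian_eq_withDensity]
  filter_upwards [h] with x hx
  have hf : (n ! : ℝ) ≠ 0 := mod_cast n.factorial_ne_zero
  rw [entropyDensity, hx, ENNReal.toReal_ofReal (sortedGaussianDensity_nonneg x)]
  by_cases hx : x ∈ monotoneCone n
  · rw [sortedGaussianDensity, Set.indicator_of_mem hx, Real.negMulLog,
      Real.log_mul hf (stdGaussianDensity_pos x).ne', smul_eq_mul]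
    have : Real.log (stdGaussianDensity x) = -(n / 2 * Real.log (2 * Real.pi)) - ‖x‖ ^ 2 / 2 := by
      rw [stdGaussianDensity, Real.log_mul (by positivity) (by positivity), Real.log_inv,
        Real.log_rpow (by positivity), Real.log_exp]
      ring
    rw [this]
    ring
  · simp [sortedGaussianDensity, hx]

lemma integrable_const_add_sq_norm_stdGaussian (a : ℝ) :
    Integrable (fun x : EuclideanSpace ℝ (Fin n) => a + ‖x‖ ^ 2 / 2)
      (stdGaussian (EuclideanSpace ℝ (Fin n))) :=
  (integrable_const a).add (integrable_sq_norm_stdGaussian.div_const 2)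

lemma integrable_entropyDensity_map_sortVec_stdGaussian :
    Integrable (entropyDensity ((stdGaussian (EuclideanSpace ℝ (Fin n))).map sortVec)) := by
  rw [integrable_congr entropyDensity_map_sortVec_stdGaussian,
    ← integrable_withDensity_iff_integrable_smul' (by fun_prop) (by simp),
    ← map_sortVec_stdGaussian_eq_withDensity, integrable_map_measure (by fun_prop) (by fun_prop)]
  simpa only [Function.comp_def, norm_sortVec] using integrable_const_add_sq_norm_stdGaussian _

/-- Sorting preserves the norm, so only the second moment `n` of the Gaussian enters. -/
lemma integral_entropyDensity_map_sortVec_stdGaussian :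
    ∫ x, entropyDensity ((stdGaussian (EuclideanSpace ℝ (Fin n))).map sortVec) x =
      -Real.log n ! + n / 2 * Real.log (2 * Real.pi) + n / 2 := by
  rw [integral_congr_ae entropyDensity_map_sortVec_stdGaussian,
    ← integral_withDensity_eq_integral_toReal_smul (by fun_prop) (by simp),
    ← map_sortVec_stdGaussian_eq_withDensity, integral_map (by fun_prop) (by fun_prop)]
  simp_rw [norm_sortVec]
  rw [integral_add (integrable_const _) (integrable_sq_norm_stdGaussian.div_const 2), integral_div,
    integral_sq_norm_stdGaussian]
  simp

lemma entropyPower_sortVec_stdGaussian (hn : n ≠ 0) :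
    n / (2 * Real.pi * Real.exp 1) * Real.exp (2 / n *
      ∫ x, entropyDensity ((stdGaussian (EuclideanSpace ℝ (Fin n))).map sortVec) x) =
        entropyVarBound n := by
  have hn0 : (0 : ℝ) < n := by positivity
  have hf : (0 : ℝ) < n ! := mod_cast n.factorial_pos
  have h : 2 / (n : ℝ) * (-Real.log n ! + n / 2 * Real.log (2 * Real.pi) + n / 2) =
      Real.log (2 * Real.pi) + 1 - Real.log n ! * (2 / n) := by
    field_simp
    ring
  rw [integral_entropyDensity_map_sortVec_stdGaussian, h, Real.exp_sub, Real.exp_add,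
    Real.exp_log (by positivity), ← Real.rpow_def_of_pos hf, entropyVarBound]
  field_simp

end Entropy

/-! ### The Gaussian channel as a rotation -/

section Channel

variable {n : ℕ}

open scoped MatrixOrder in
lemma multivariateGaussian_sq_smul_one {σ : ℝ} (hσ : 0 ≤ σ) (x : EuclideanSpace ℝ (Fin n)) :
    multivariateGaussian x (σ ^ 2 • (1 : Matrix (Fin n) (Fin n) ℝ)) =
      (stdGaussian _).map fun z => x + σ • z := by
  have h : CFC.sqrt (σ ^ 2 • (1 : Matrix (Fin n) (Fin n) ℝ)) = σ • 1 := by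
    refine CFC.sqrt_unique (by simp [smul_smul, sq]) ?_
    exact Matrix.nonneg_iff_posSemidef.2 (Matrix.PosSemidef.one.smul hσ)
  rw [multivariateGaussian, h]
  simp

lemma IsGaussianChannel.map_prodMk_eq {Ω : Type*} [MeasurableSpace Ω] {P : Measure Ω}
    [IsProbabilityMeasure P] {X Y : Ω → EuclideanSpace ℝ (Fin n)} {σ : ℝ} (hσ : 0 ≤ σ)
    (h : IsGaussianChannel σ X Y P) (hX : P.map X = stdGaussian _) :
    P.map (fun ω => (X ω, Y ω)) =
      ((stdGaussian (EuclideanSpace ℝ (Fin n))).prod (stdGaussian _)).map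
        fun p => (p.1, p.1 + σ • p.2) := by
  rw [← compProd_map_condDistrib h.1.aemeasurable]
  ext A hA
  rw [Measure.compProd_apply hA, Measure.map_apply (by fun_prop) hA,
    Measure.prod_apply (hA.preimage (by fun_prop)), hX.symm]
  refine lintegral_congr_ae ?_
  filter_upwards [h.2] with x hx
  rw [hx, multivariateGaussian_sq_smul_one hσ, hX,
    Measure.map_apply (by fun_prop) (hA.preimage (by fun_prop))]
  rfl

lemma map_stdGaussian_prod_rotation (θ : ℝ) :
    ((stdGaussian (EuclideanSpace ℝ (Fin n))).prod (stdGaussian _)).map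
      (ContinuousLinearMap.rotation θ) = (stdGaussian _).prod (stdGaussian _) := by
  apply IsGaussian.map_rotation_eq_self
  simp

lemma map_neg_snd_stdGaussian_prod :
    ((stdGaussian (EuclideanSpace ℝ (Fin n))).prod (stdGaussian (EuclideanSpace ℝ (Fin n)))).map
      (Prod.map id fun w => -w) = (stdGaussian _).prod (stdGaussian _) := by
  have h : (stdGaussian (EuclideanSpace ℝ (Fin n))).map (fun w => -w) = stdGaussian _ :=
    stdGaussian_map (LinearIsometryEquiv.neg ℝ)
  rw [← Measure.map_prod_map _ _ measurable_id measurable_neg, Measure.map_id, h]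

/-- The two parametrizations of the pair (input, output) differ by an orthogonal change of variables
in the product space, which preserves the Gaussian law. -/
lemma map_stdGaussian_prod_channel (σ : ℝ) :
    ((stdGaussian (EuclideanSpace ℝ (Fin n))).prod (stdGaussian _)).map
        (fun p => (p.1, p.1 + σ • p.2)) =
      ((stdGaussian (EuclideanSpace ℝ (Fin n))).prod (stdGaussian _)).map
        fun p => ((√(1 + σ ^ 2))⁻¹ • p.1 + (σ / √(1 + σ ^ 2)) • p.2, √(1 + σ ^ 2) • p.1) := by
  have hr : 0 < √(1 + σ ^ 2) := by positivity
  have hr2 : √(1 + σ ^ 2) ^ 2 = 1 + σ ^ 2 := Real.sq_sqrt (by positivity)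
  have hcos := Real.cos_arctan σ
  have hsin := Real.sin_arctan σ
  -- The angle `arctan σ` has cosine `1/r` and sine `σ/r`; the reflection of the second factor fixes
  -- the remaining sign.
  conv_rhs => rw [← map_neg_snd_stdGaussian_prod, ← map_stdGaussian_prod_rotation (Real.arctan σ)]
  rw [Measure.map_map (by fun_prop) (by fun_prop), Measure.map_map (by fun_prop) (by fun_prop)]
  congr 1
  ext p : 1
  simp only [Function.comp_apply, ContinuousLinearMap.rotation_apply, hcos, hsin, Prod.map_apply,
    id_eq, Prod.mk.injEq]
  set r := √(1 + σ ^ 2)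
  constructor
  · have h1 : r⁻¹ * (1 / r) + σ / r * (σ / r) = 1 := by field_simp; linarith
    have h2 : r⁻¹ * (σ / r) - σ / r * (1 / r) = 0 := by field_simp; ring
    calc p.1 = (r⁻¹ * (1 / r) + σ / r * (σ / r)) • p.1 +
        (r⁻¹ * (σ / r) - σ / r * (1 / r)) • p.2 := by rw [h1, h2]; simp
      _ = _ := by module
  · have h1 : r * (1 / r) = 1 := by field_simp
    have h2 : r * (σ / r) = σ := by field_simp
    rw [smul_add, smul_smul, smul_smul, h1, h2, one_smul]

/-- The input and output of a Gaussian channel with standard Gaussian input are linear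
combinations of two independent standard Gaussian vectors, the first of which is proportional
to the output. -/
lemma IsGaussianChannel.exists_map_eq_stdGaussian_prod {Ω : Type*} [MeasurableSpace Ω]
    {P : Measure Ω} [IsProbabilityMeasure P] {X Y : Ω → EuclideanSpace ℝ (Fin n)} {σ : ℝ}
    (hσ : 0 < σ) (h : IsGaussianChannel σ X Y P) (hXm : Measurable X)
    (hX : P.map X = stdGaussian _) :
    ∃ V W : Ω → EuclideanSpace ℝ (Fin n), Measurable V ∧ Measurable W ∧
      P.map (fun ω => (V ω, W ω)) = (stdGaussian _).prod (stdGaussian _) ∧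
      (∀ ω, X ω = (√(1 + σ ^ 2))⁻¹ • V ω + (σ / √(1 + σ ^ 2)) • W ω) ∧
      ∀ ω, Y ω = √(1 + σ ^ 2) • V ω := by
  have hr : √(1 + σ ^ 2) ≠ 0 := by positivity
  have hYm : Measurable Y := h.1
  set r := √(1 + σ ^ 2) with hrdef
  -- `V` and `W` are obtained by solving the two linear relations.
  refine ⟨fun ω => r⁻¹ • Y ω, fun ω => (r / σ) • (X ω - r⁻¹ • r⁻¹ • Y ω), by fun_prop, by fun_prop,
    ?_, fun ω => ?_, fun ω => (smul_inv_smul₀ hr _).symm⟩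
  · have hcomp : (fun ω => (r⁻¹ • Y ω, (r / σ) • (X ω - r⁻¹ • r⁻¹ • Y ω))) =
        (fun p : EuclideanSpace ℝ (Fin n) × EuclideanSpace ℝ (Fin n) =>
          (r⁻¹ • p.2, (r / σ) • (p.1 - r⁻¹ • r⁻¹ • p.2))) ∘ fun ω => (X ω, Y ω) := rfl
    rw [hcomp, ← Measure.map_map (by fun_prop) (by fun_prop), h.map_prodMk_eq hσ.le hX,
      map_stdGaussian_prod_channel, Measure.map_map (by fun_prop) (by fun_prop)]
    refine Eq.trans ?_ Measure.map_id
    congr 1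
    ext p : 1
    have h1 : r / σ * (σ / r) = 1 := by field_simp
    have h2 : (r / σ) • (σ / r) • p.2 = p.2 := by rw [smul_smul, h1, one_smul]
    simp [← hrdef, inv_smul_smul₀ hr, h2]
  · have h1 : σ / r * (r / σ) = 1 := by field_simp
    rw [smul_smul (σ / r), h1, one_smul]
    abel

end Channel

/-! ### Mean square errors as distances in L² -/

section MeanSquare

variable {Ω E F : Type*} [MeasurableSpace Ω] [NormedAddCommGroup E] [InnerProductSpace ℝ E]
  {P : Measure Ω}

lemma norm_toLp_sq_eq_integral {f : Ω → E} (hf : MemLp f 2 P) :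
    ‖hf.toLp f‖ ^ 2 = ∫ ω, ‖f ω‖ ^ 2 ∂P := by
  rw [← real_inner_self_eq_norm_sq, L2.inner_def]
  refine integral_congr_ae ?_
  filter_upwards [hf.coeFn_toLp] with ω hω
  rw [hω, real_inner_self_eq_norm_sq]

lemma norm_toLp_sub_toLp_sq_eq_integral {f g : Ω → E} (hf : MemLp f 2 P) (hg : MemLp g 2 P) :
    ‖hf.toLp f - hg.toLp g‖ ^ 2 = ∫ ω, ‖f ω - g ω‖ ^ 2 ∂P := by
  rw [← MemLp.toLp_sub hf hg, norm_toLp_sq_eq_integral]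
  rfl

lemma sqrt_integral_sq_norm_le_add {f g : Ω → E} (hf : MemLp f 2 P) (hg : MemLp g 2 P) :
    √(∫ ω, ‖f ω‖ ^ 2 ∂P) ≤ √(∫ ω, ‖g ω‖ ^ 2 ∂P) + √(∫ ω, ‖f ω - g ω‖ ^ 2 ∂P) := by
  rw [← norm_toLp_sq_eq_integral hf, ← norm_toLp_sq_eq_integral hg,
    ← norm_toLp_sub_toLp_sq_eq_integral hf hg,
    Real.sqrt_sq (norm_nonneg _), Real.sqrt_sq (norm_nonneg _), Real.sqrt_sq (norm_nonneg _)]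
  exact norm_le_norm_add_norm_sub' _ _

variable [CompleteSpace E] [IsProbabilityMeasure P]

/-- Expanding around the mean, the cross term integrates to zero. -/
lemma vecVar_le_integral_sq_norm_sub {f : Ω → E} (hf : MemLp f 2 P) (c : E) :
    vecVar f P ≤ ∫ ω, ‖f ω - c‖ ^ 2 ∂P := by
  set e := ∫ ω, f ω ∂P with he
  have hfi : Integrable f P := hf.integrable (by norm_num)
  have hfe : Integrable (fun ω => f ω - e) P := hfi.sub (integrable_const e)
  have hfe2 : Integrable (fun ω => ‖f ω - e‖ ^ 2) P :=
    (hf.sub (memLp_const e)).integrable_norm_pow (by norm_num)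
  have hexp (ω : Ω) : ‖f ω - c‖ ^ 2 =
      ‖f ω - e‖ ^ 2 + (2 * inner ℝ (e - c) (f ω - e) + ‖e - c‖ ^ 2) := by
    rw [← sub_add_sub_cancel (f ω) e c, norm_add_sq_real, real_inner_comm]
    ring
  have h0 : ∫ ω, inner ℝ (e - c) (f ω - e) ∂P = 0 := by
    rw [integral_inner hfe, integral_sub hfi (integrable_const e)]
    simp [he]
  have hi2 : Integrable (fun ω => 2 * inner ℝ (e - c) (f ω - e)) P :=
    (hfe.const_inner _).const_mul 2
  have hi3 : Integrable (fun ω => 2 * inner ℝ (e - c) (f ω - e) + ‖e - c‖ ^ 2) P :=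
    hi2.add (integrable_const _)
  simp_rw [hexp]
  rw [integral_add hfe2 hi3, integral_add hi2 (integrable_const _), integral_const_mul, h0]
  simp only [mul_zero, zero_add, integral_const, probReal_univ, one_smul]
  exact le_add_of_nonneg_right (sq_nonneg _)

variable [MeasurableSpace F]

/-- Conditional expectation is the orthogonal projection in L² onto the functions measurable with
respect to `U`, and constants are among these. -/
lemma mmse_le_vecVar {V : Ω → E} {U : Ω → F} (hV : MemLp V 2 P) (hU : Measurable U) :
    mmse V U P ≤ vecVar V P := by
  have hm : MeasurableSpace.comap U inferInstance ≤ (inferInstance : MeasurableSpace Ω) :=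
    hU.comap_le
  set K := lpMeas E ℝ (MeasurableSpace.comap U inferInstance) 2 P
  have : Fact (MeasurableSpace.comap U inferInstance ≤ (inferInstance : MeasurableSpace Ω)) := ⟨hm⟩
  set c := ∫ ω, V ω ∂P
  have hc : MemLp (fun _ : Ω => c) 2 P := memLp_const c
  have hcK : hc.toLp _ ∈ K := mem_lpMeas_iff_aestronglyMeasurable.2
    ⟨fun _ => c, stronglyMeasurable_const, hc.coeFn_toLp⟩
  have hE : MemLp (P[V | MeasurableSpace.comap U inferInstance]) 2 P := hV.condExp (by norm_num)
  have hproj : hE.toLp _ = K.starProjection (hV.toLp V) := by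
    refine Lp.ext ?_
    exact hE.coeFn_toLp.trans (hV.condExpL2_ae_eq_condExp (𝕜 := ℝ) hm).symm
  rw [mmse, vecVar, ← norm_toLp_sub_toLp_sq_eq_integral hV hE,
    ← norm_toLp_sub_toLp_sq_eq_integral hV hc, hproj,
    Submodule.starProjection_minimal]
  gcongr
  · exact Real.iInf_nonneg fun _ => norm_nonneg _
  · exact ciInf_le ⟨0, by rintro _ ⟨_, rfl⟩; exact norm_nonneg _⟩ (⟨_, hcK⟩ : K)

end MeanSquare

/-! ### Estimation of the sorted input -/

section SortedChannel

variable {n : ℕ} {Ω : Type*} [MeasurableSpace Ω] {P : Measure Ω}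
  {V W X Y : Ω → EuclideanSpace ℝ (Fin n)}

lemma map_fst_of_map_prodMk_eq (hV : Measurable V) (hW : Measurable W)
    (h : P.map (fun ω => (V ω, W ω)) = (stdGaussian _).prod (stdGaussian _)) :
    P.map V = stdGaussian _ := by
  have := congrArg (Measure.map Prod.fst) h
  rwa [Measure.map_map measurable_fst (hV.prodMk hW), Measure.map_fst_prod, measure_univ,
    one_smul] at this

lemma map_snd_of_map_prodMk_eq (hV : Measurable V) (hW : Measurable W)
    (h : P.map (fun ω => (V ω, W ω)) = (stdGaussian _).prod (stdGaussian _)) :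
    P.map W = stdGaussian _ := by
  have := congrArg (Measure.map Prod.snd) h
  rwa [Measure.map_map measurable_snd (hV.prodMk hW), Measure.map_snd_prod, measure_univ,
    one_smul] at this

lemma memLp_of_map_eq_stdGaussian (hX : Measurable X) (h : P.map X = stdGaussian _) :
    MemLp X 2 P := by
  have := memLp_id_stdGaussian (n := n)
  rw [← h, memLp_map_measure_iff (by fun_prop) hX.aemeasurable] at this
  exact this

lemma integral_sq_norm_of_map_eq_stdGaussian (hX : Measurable X) (h : P.map X = stdGaussian _) :
    ∫ ω, ‖X ω‖ ^ 2 ∂P = n := by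
  rw [← integral_sq_norm_stdGaussian (n := n), ← h, integral_map hX.aemeasurable (by fun_prop)]

lemma integral_eq_zero_of_map_eq_stdGaussian (hX : Measurable X) (h : P.map X = stdGaussian _) :
    ∫ ω, X ω ∂P = 0 := by
  have := integral_id_stdGaussian (E := EuclideanSpace ℝ (Fin n))
  rwa [← h, integral_map hX.aemeasurable (by fun_prop)] at this

/-- The conditional expectation given the sorted output is a function of the output. -/
lemma exists_measurable_mmse_sortVec_eq {r : ℝ} (hYe : ∀ ω, Y ω = r • V ω)
    (hX : MemLp X 2 P) :
    ∃ g : EuclideanSpace ℝ (Fin n) → EuclideanSpace ℝ (Fin n), Measurable g ∧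
      MemLp (fun ω => g (V ω)) 2 P ∧
      mmse (fun ω => sortVec (X ω)) (fun ω => sortVec (Y ω)) P =
        ∫ ω, ‖sortVec (X ω) - g (V ω)‖ ^ 2 ∂P := by
  -- Doob–Dynkin factorization through the sorted output.
  obtain ⟨g, hg, hge⟩ := (stronglyMeasurable_condExp (μ := P) (f := fun ω => sortVec (X ω))
    (m := MeasurableSpace.comap (fun ω => sortVec (Y ω))
      inferInstance)).measurable.exists_eq_measurable_comp
  have hge' (ω : Ω) : (P[fun ω => sortVec (X ω) | MeasurableSpace.comap (fun ω => sortVec (Y ω))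
      inferInstance]) ω = g (sortVec (r • V ω)) := by
    rw [hge, Function.comp_apply, hYe]
  refine ⟨fun v => g (sortVec (r • v)), by fun_prop, ?_, ?_⟩
  · have := hX.sortVec.condExp (m := MeasurableSpace.comap (fun ω => sortVec (Y ω)) inferInstance)
      (by norm_num)
    rwa [funext hge'] at this
  · simp_rw [mmse, hge']

/-- A lower bound for an expectation given the first of two independent standard Gaussian vectors
is a lower bound for the expectation. -/
lemma le_integral_of_forall_le_integral (hV : Measurable V) (hW : Measurable W)
    (h : P.map (fun ω => (V ω, W ω)) = (stdGaussian _).prod (stdGaussian _))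
    {G : EuclideanSpace ℝ (Fin n) → EuclideanSpace ℝ (Fin n) → ℝ}
    (hG : Measurable (Function.uncurry G)) (hi : Integrable (fun ω => G (V ω) (W ω)) P) {K : ℝ}
    (hK : ∀ v, K ≤ ∫ w, G v w ∂stdGaussian _) : K ≤ ∫ ω, G (V ω) (W ω) ∂P := by
  have hVW : Measurable fun ω => (V ω, W ω) := hV.prodMk hW
  have hi' : Integrable (Function.uncurry G) ((stdGaussian _).prod (stdGaussian _)) := by
    rw [← h, integrable_map_measure hG.aestronglyMeasurable hVW.aemeasurable]
    exact hi
  have he : ∫ ω, G (V ω) (W ω) ∂P = ∫ v, ∫ w, G v w ∂stdGaussian _ ∂stdGaussian _ := by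
    refine Eq.trans ?_ (integral_prod _ hi')
    rw [← h, integral_map hVW.aemeasurable hG.aestronglyMeasurable]
    rfl
  rw [he]
  calc K = ∫ _, K ∂stdGaussian (EuclideanSpace ℝ (Fin n)) := by simp
    _ ≤ _ := integral_mono (integrable_const K) hi'.integral_prod_left hK

variable [IsProbabilityMeasure P]

lemma indepFun_of_map_prodMk_eq (hV : Measurable V) (hW : Measurable W)
    (h : P.map (fun ω => (V ω, W ω)) = (stdGaussian _).prod (stdGaussian _)) :
    IndepFun V W P := by
  rw [indepFun_iff_map_prod_eq_prod_map_map hV.aemeasurable hW.aemeasurable, h,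
    map_fst_of_map_prodMk_eq hV hW h, map_snd_of_map_prodMk_eq hV hW h]

namespace IsGaussianChannel

variable {σ : ℝ}

/-- Given `Y`, the part `V/r` of `X` is known, while `(σ/r) W` is independent of `Y` and centred;
the error is therefore exactly `(σ/r) W`. -/
lemma mmse_eq (hσ : 0 < σ) (h : IsGaussianChannel σ X Y P) (hXm : Measurable X)
    (hX : P.map X = stdGaussian _) : mmse X Y P = n * (σ ^ 2 / (1 + σ ^ 2)) := by
  obtain ⟨V, W, hV, hW, hVW, hXe, hYe⟩ := h.exists_map_eq_stdGaussian_prod hσ hXm hX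
  have hYm := h.1
  have hr : √(1 + σ ^ 2) ≠ 0 := by positivity
  have hr2 : √(1 + σ ^ 2) ^ 2 = 1 + σ ^ 2 := Real.sq_sqrt (by positivity)
  set r := √(1 + σ ^ 2)
  have hWmap := map_snd_of_map_prodMk_eq hV hW hVW
  have hVL := memLp_of_map_eq_stdGaussian hV (map_fst_of_map_prodMk_eq hV hW hVW)
  have hWL := memLp_of_map_eq_stdGaussian hW hWmap
  have hVi : Integrable (fun ω => r⁻¹ • V ω) P := (hVL.const_smul r⁻¹).integrable (by norm_num)
  have hWi : Integrable (fun ω => (σ / r) • W ω) P :=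
    (hWL.const_smul (σ / r)).integrable (by norm_num)
  have hind : IndepFun (fun ω => (σ / r) • W ω) Y P := by
    rw [show Y = fun ω => r • V ω from funext hYe]
    exact (indepFun_of_map_prodMk_eq hV hW hVW).symm.comp (measurable_const_smul (σ / r))
      (measurable_const_smul r)
  have hVs : StronglyMeasurable[MeasurableSpace.comap Y inferInstance] fun ω => r⁻¹ • V ω := by
    have : (fun ω => r⁻¹ • V ω) = fun ω => r⁻¹ • r⁻¹ • Y ω := by
      ext1 ω; rw [hYe, inv_smul_smul₀ hr]
    rw [this]
    exact (((comap_measurable Y).const_smul r⁻¹).const_smul r⁻¹).stronglyMeasurable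
  have hE : P[X | MeasurableSpace.comap Y inferInstance] =ᵐ[P] fun ω => r⁻¹ • V ω := by
    rw [show X = (fun ω => r⁻¹ • V ω) + fun ω => (σ / r) • W ω from funext hXe]
    refine (condExp_add hVi hWi _).trans ?_
    have h1 := condExp_of_stronglyMeasurable hYm.comap_le hVs hVi
    have h2 := condExp_indep_eq (μ := P) (f := fun ω => (σ / r) • W ω)
      ((hW.const_smul (σ / r)).comap_le) hYm.comap_le
      (comap_measurable _).stronglyMeasurable ((IndepFun_iff_Indep _ _ _).1 hind)
    filter_upwards [h2] with ω hω
    rw [Pi.add_apply, h1, hω, integral_smul, integral_eq_zero_of_map_eq_stdGaussian hW hWmap,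
      smul_zero, add_zero]
  have : mmse X Y P = ∫ ω, (σ / r) ^ 2 * ‖W ω‖ ^ 2 ∂P := by
    refine integral_congr_ae ?_
    filter_upwards [hE] with ω hω
    rw [hω, hXe, add_sub_cancel_left, norm_smul, mul_pow, Real.norm_eq_abs, sq_abs]
  rw [this, integral_const_mul, integral_sq_norm_of_map_eq_stdGaussian hW hWmap, div_pow, hr2]
  ring

/-- With `V = v` frozen, the input is a Gaussian with centre `v/r` and scale `σ/r`, and the estimate
`g v` is a constant. -/
lemma mmse_sortVec_ge (hσ : 0 < σ) (h : IsGaussianChannel σ X Y P) (hXm : Measurable X)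
    (hX : P.map X = stdGaussian _) :
    1 / (n ! : ℝ) ^ (2 / (n : ℝ)) * (n * (σ ^ 2 / (1 + σ ^ 2))) ≤
      mmse (fun ω => sortVec (X ω)) (fun ω => sortVec (Y ω)) P := by
  obtain ⟨V, W, hV, hW, hVW, hXe, hYe⟩ := h.exists_map_eq_stdGaussian_prod hσ hXm hX
  have hr : 0 < √(1 + σ ^ 2) := by positivity
  have hr2 : √(1 + σ ^ 2) ^ 2 = 1 + σ ^ 2 := Real.sq_sqrt (by positivity)
  have hXL := memLp_of_map_eq_stdGaussian hXm hX
  obtain ⟨g, hg, hgL, hge⟩ := exists_measurable_mmse_sortVec_eq hYe hXL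
  have hi := (hXL.sortVec.sub hgL).integrable_norm_pow (by norm_num)
  simp only [Pi.sub_apply, hXe] at hi
  simp_rw [hge, hXe]
  refine le_integral_of_forall_le_integral hV hW hVW (G := fun v w =>
    ‖sortVec ((√(1 + σ ^ 2))⁻¹ • v + (σ / √(1 + σ ^ 2)) • w) - g v‖ ^ 2) (by fun_prop) hi
    fun v => ?_
  refine le_trans (le_of_eq ?_) (le_integral_sq_norm_sortVec_add_smul_sub (by positivity) _ _)
  rw [div_pow, hr2]
  ring

/-- A triangle inequality in L² replaces `X` by `(σ/r) W`. It serves the limit `σ → ∞`, where `σ/r →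
1` and `1/r → 0`. -/
lemma sqrt_mmse_sortVec_ge (hσ : 0 < σ) (h : IsGaussianChannel σ X Y P) (hXm : Measurable X)
    (hX : P.map X = stdGaussian _) :
    σ / √(1 + σ ^ 2) * √(vecVar sortVec (stdGaussian (EuclideanSpace ℝ (Fin n)))) -
      (√(1 + σ ^ 2))⁻¹ * √n ≤
        √(mmse (fun ω => sortVec (X ω)) (fun ω => sortVec (Y ω)) P) := by
  obtain ⟨V, W, hV, hW, hVW, hXe, hYe⟩ := h.exists_map_eq_stdGaussian_prod hσ hXm hX
  have hr : 0 < √(1 + σ ^ 2) := by positivity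
  have hXL := memLp_of_map_eq_stdGaussian hXm hX
  obtain ⟨g, hg, hgL, hge⟩ := exists_measurable_mmse_sortVec_eq hYe hXL
  set r := √(1 + σ ^ 2)
  have hs : 0 < σ / r := by positivity
  have hVmap := map_fst_of_map_prodMk_eq hV hW hVW
  have hVL := memLp_of_map_eq_stdGaussian hV hVmap
  have hWL := memLp_of_map_eq_stdGaussian hW (map_snd_of_map_prodMk_eq hV hW hVW)
  have hsW : MemLp (fun ω => sortVec ((σ / r) • W ω)) 2 P := (hWL.const_smul (σ / r)).sortVec
  -- `W` is independent of `V`, so `g (V ω)` acts as a constant guess and cannot beat the variance.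
  have hvar : (σ / r) ^ 2 * vecVar sortVec (stdGaussian (EuclideanSpace ℝ (Fin n))) ≤
      ∫ ω, ‖sortVec ((σ / r) • W ω) - g (V ω)‖ ^ 2 ∂P := by
    refine le_integral_of_forall_le_integral hV hW hVW
      (G := fun v w => ‖sortVec ((σ / r) • w) - g v‖ ^ 2) (by fun_prop)
      ((hsW.sub hgL).integrable_norm_pow (by norm_num)) fun v => ?_
    have he (w : EuclideanSpace ℝ (Fin n)) : ‖sortVec ((σ / r) • w) - g v‖ ^ 2 =
        (σ / r) ^ 2 * ‖sortVec w - (σ / r)⁻¹ • g v‖ ^ 2 := by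
      rw [← sq_abs (σ / r), ← Real.norm_eq_abs, ← mul_pow, ← norm_smul, smul_sub,
        smul_inv_smul₀ hs.ne', sortVec_smul hs.le]
    simp_rw [he]
    rw [integral_const_mul]
    gcongr
    exact vecVar_le_integral_sq_norm_sub memLp_id_stdGaussian.sortVec _
  -- The estimate `g` cancels, and by the Lipschitz bound the error is at most `‖V‖/r`.
  have hdist : ∫ ω, ‖sortVec ((σ / r) • W ω) - g (V ω) - (sortVec (X ω) - g (V ω))‖ ^ 2 ∂P ≤
      r⁻¹ ^ 2 * n := by
    rw [← integral_sq_norm_of_map_eq_stdGaussian hV hVmap, ← integral_const_mul]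
    refine integral_mono_of_nonneg (ae_of_all _ fun _ => sq_nonneg _)
      ((hVL.integrable_norm_pow (by norm_num)).const_mul _) (ae_of_all _ fun ω => ?_)
    have hle := norm_sortVec_sub_sortVec_le ((σ / r) • W ω) (X ω)
    rw [hXe ω, sub_add_cancel_right, norm_neg, norm_smul, Real.norm_of_nonneg (by positivity),
      ← hXe ω] at hle
    simp only [sub_sub_sub_cancel_right]
    rw [← mul_pow]
    gcongr
  have htri := sqrt_integral_sq_norm_le_add (hsW.sub hgL) (hXL.sortVec.sub hgL)
  simp only [Pi.sub_apply] at htri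
  rw [← hge] at htri
  have h1 := Real.sqrt_le_sqrt hvar
  have h2 := Real.sqrt_le_sqrt hdist
  rw [Real.sqrt_mul (sq_nonneg _), Real.sqrt_sq (by positivity)] at h1 h2
  linarith

end IsGaussianChannel

/-- Square roots are squeezed between the triangle inequality bound and the variance, then squared.
-/
lemma tendsto_mmse_sortVec {Y : ℝ → Ω → EuclideanSpace ℝ (Fin n)}
    (hY : ∀ σ : ℝ, 0 < σ → IsGaussianChannel σ X (Y σ) P) (hXm : Measurable X)
    (hX : P.map X = stdGaussian _) :
    Tendsto (fun σ => mmse (fun ω => sortVec (X ω)) (fun ω => sortVec (Y σ ω)) P) atTop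
      (𝓝 (vecVar (fun ω => sortVec (X ω)) P)) := by
  have hvar : vecVar (fun ω => sortVec (X ω)) P =
      vecVar sortVec (stdGaussian (EuclideanSpace ℝ (Fin n))) := by
    rw [vecVar_map hXm.aemeasurable measurable_sortVec.aestronglyMeasurable, hX]
  have hm0 (σ : ℝ) : 0 ≤ mmse (fun ω => sortVec (X ω)) (fun ω => sortVec (Y σ ω)) P :=
    integral_nonneg fun _ => sq_nonneg _
  have hv0 : 0 ≤ vecVar (fun ω => sortVec (X ω)) P := integral_nonneg fun _ => sq_nonneg _
  have hr : Tendsto (fun σ : ℝ => (√(1 + σ ^ 2))⁻¹) atTop (𝓝 0) :=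
    (Real.tendsto_sqrt_atTop.comp
      (tendsto_atTop_add_const_left _ _ (tendsto_pow_atTop two_ne_zero))).inv_tendsto_atTop
  have hs : Tendsto (fun σ : ℝ => σ / √(1 + σ ^ 2)) atTop (𝓝 1) := by
    -- For `σ > 0`, `σ/r = √(1 - r⁻²)`.
    have := ((hr.pow 2).const_sub 1).sqrt
    simp only [ne_eq, OfNat.ofNat_ne_zero, not_false_eq_true, zero_pow, sub_zero,
      Real.sqrt_one] at this
    refine this.congr' ?_
    filter_upwards [eventually_gt_atTop 0] with σ hσ
    have hr2 : √(1 + σ ^ 2) ^ 2 = 1 + σ ^ 2 := Real.sq_sqrt (by positivity)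
    rw [Real.sqrt_eq_iff_mul_self_eq_of_pos (by positivity), inv_pow, hr2, ← sq, div_pow, hr2]
    field_simp
    ring
  have hlow := (hs.mul_const √(vecVar sortVec (stdGaussian (EuclideanSpace ℝ (Fin n))))).sub
    (hr.mul_const √n)
  rw [one_mul, zero_mul, sub_zero, ← hvar] at hlow
  have hsq := (tendsto_of_tendsto_of_tendsto_of_le_of_le' hlow tendsto_const_nhds
    (g := fun _ => _) (f := fun σ => √(mmse (fun ω => sortVec (X ω)) (fun ω => sortVec (Y σ ω)) P))
    (by
      filter_upwards [eventually_gt_atTop 0] with σ hσ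
      rw [hvar]
      exact (hY σ hσ).sqrt_mmse_sortVec_ge hσ hXm hX)
    (by
      filter_upwards [eventually_gt_atTop 0] with σ hσ
      exact Real.sqrt_le_sqrt (mmse_le_vecVar (memLp_of_map_eq_stdGaussian hXm hX).sortVec
        (measurable_sortVec.comp (hY σ hσ).1)))).pow 2
  simpa only [Real.sq_sqrt (hm0 _), Real.sq_sqrt hv0] using hsq

lemma tendsto_mmse {Y : ℝ → Ω → EuclideanSpace ℝ (Fin n)}
    (hY : ∀ σ : ℝ, 0 < σ → IsGaussianChannel σ X (Y σ) P) (hXm : Measurable X)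
    (hX : P.map X = stdGaussian _) : Tendsto (fun σ => mmse X (Y σ) P) atTop (𝓝 n) := by
  have hr : Tendsto (fun σ : ℝ => (1 + σ ^ 2)⁻¹) atTop (𝓝 0) :=
    (tendsto_atTop_add_const_left _ _ (tendsto_pow_atTop two_ne_zero)).inv_tendsto_atTop
  have := (hr.const_sub 1).const_mul (n : ℝ)
  rw [sub_zero, mul_one] at this
  refine this.congr' ?_
  filter_upwards [eventually_gt_atTop 0] with σ hσ
  rw [(hY σ hσ).mmse_eq hσ hXm hX]
  field_simp
  ring

end SortedChannel

theorem theorem9 :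
    (∀ n : ℕ, 1 ≤ n → ∀ (Ω : Type*) [MeasurableSpace Ω] (P : Measure Ω) [IsProbabilityMeasure P]
      (X : Ω → EuclideanSpace ℝ (Fin n)), Measurable X →
      P.map X = multivariateGaussian 0 (1 : Matrix (Fin n) (Fin n) ℝ) →
      -- the bound for a fixed noise level
      (∀ σ : ℝ, 0 < σ → ∀ Y : Ω → EuclideanSpace ℝ (Fin n), IsGaussianChannel σ X Y P →
        mmse (fun ω => sortVec (X ω)) (fun ω => sortVec (Y ω)) P ≥
            1 / (n ! : ℝ) ^ (2 / (n : ℝ)) * mmse X Y P ∧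
          mmse X Y P = n * (σ ^ 2 / (1 + σ ^ 2))) ∧
      -- both sides of the bound as the noise level tends to infinity
      (∀ Y : ℝ → Ω → EuclideanSpace ℝ (Fin n),
        (∀ σ : ℝ, 0 < σ → IsGaussianChannel σ X (Y σ) P) →
        Tendsto (fun σ => mmse (fun ω => sortVec (X ω)) (fun ω => sortVec (Y σ ω)) P) atTop
            (𝓝 (vecVar (fun ω => sortVec (X ω)) P)) ∧
          Tendsto (fun σ => 1 / (n ! : ℝ) ^ (2 / (n : ℝ)) * mmse X (Y σ) P) atTop
            (𝓝 (entropyVarBound n))) ∧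
      -- the limiting bound, with the differential entropy of the sorted vector
      P.map (fun ω => sortVec (X ω)) ≪ volume ∧
      Integrable (entropyDensity (P.map (fun ω => sortVec (X ω)))) volume ∧
      vecVar (fun ω => sortVec (X ω)) P ≥
        n / (2 * Real.pi * Real.exp 1) *
          Real.exp (2 / n * diffEntropy (fun ω => sortVec (X ω)) P) ∧
      n / (2 * Real.pi * Real.exp 1) *
          Real.exp (2 / n * diffEntropy (fun ω => sortVec (X ω)) P) = entropyVarBound n) ∧
    -- order of magnitude of the limiting bound: `n^(-(n+1)/n)` up to the factor `e²`
    Tendsto (fun n : ℕ => entropyVarBound n / (1 / (n : ℝ) ^ (((n : ℝ) + 1) / n))) atTop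
      (𝓝 (Real.exp 2)) ∧
    -- the limiting bound decreases with `n` to zero
    AntitoneOn entropyVarBound (Set.Ici 1) ∧
    StrictAntiOn entropyVarBound (Set.Ici 2) ∧
    Tendsto entropyVarBound atTop (𝓝 0) ∧
    -- it is of strictly smaller order than the variance that it bounds
    Tendsto (fun n : ℕ => entropyVarBound n /
      vecVar (sortVec : EuclideanSpace ℝ (Fin n) → EuclideanSpace ℝ (Fin n))
        (multivariateGaussian 0 (1 : Matrix (Fin n) (Fin n) ℝ))) atTop (𝓝 0) := by
  refine ⟨fun n hn Ω _ P _ X hXm hX => ?_, tendsto_entropyVarBound_div, antitoneOn_entropyVarBound,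
    strictAntiOn_entropyVarBound, tendsto_entropyVarBound_zero, tendsto_entropyVarBound_div_vecVar⟩
  rw [multivariateGaussian_zero_one] at hX
  have hmap : P.map (fun ω => sortVec (X ω)) = (stdGaussian _).map sortVec := by
    rw [← hX, Measure.map_map measurable_sortVec hXm]
    rfl
  have hpow := entropyPower_sortVec_stdGaussian (n := n) (by lia)
  refine ⟨fun σ hσ Y hY => ?_, fun Y hY => ⟨tendsto_mmse_sortVec hY hXm hX, ?_⟩, ?_, ?_, ?_, ?_⟩
  · rw [hY.mmse_eq hσ hXm hX]
    exact ⟨hY.mmse_sortVec_ge hσ hXm hX, rfl⟩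
  · have := (tendsto_mmse hY hXm hX).const_mul (1 / (n ! : ℝ) ^ (2 / (n : ℝ)))
    rwa [one_div_mul_eq_div] at this
  · rw [hmap]
    exact map_sortVec_stdGaussian_absolutelyContinuous
  · rw [hmap]
    exact integrable_entropyDensity_map_sortVec_stdGaussian
  · rw [diffEntropy, hmap, hpow,
      vecVar_map hXm.aemeasurable measurable_sortVec.aestronglyMeasurable, hX]
    exact entropyVarBound_le_vecVar_sortVec
  · rw [diffEntropy, hmap, hpow]
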